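/- Let $T_0=0$, $T_1=T_2=1$ and $T_i=T_{i-1}+T_{i-2}+T_{i-3}$ for $i\ge 3$ be the Tribonacci numbers, and let $\psi=1.839\cdots$ be the Tribonacci constant, the unique real zero of $X^3-X^2-X-1$. The Tribonacci representation of a natural number $n$ is the unique binary word $e_te_{t-1}\cdots e_2$ without leading zero and without three consecutive $1$'s such that $n=\sum_{2\le i\le t}e_iT_i$ (the empty word for $n=0$). Then: (a) The sequence $a(n)=\lfloor\psi n\rfloor$ $(n\ge 0)$ is not Tribonacci-synchronized: there is no deterministic finite automaton that reads, most significant digit first, the Tribonacci representations of any two natural numbers $n$ and $x$ in parallel (the shorter one padded on the left with zeros) and accepts if and only if $x=\lfloor\psi n\rfloor$. (b) The Sturmian sequence $b(n)=\lfloor(\psi-1)(n+2)\rfloor-\lfloor(\psi-1)(n+1)\rfloor$ $(n\ge 0)$ is not Tribonacci-automatic: there is no deterministic finite automaton with output that, for every $n\ge 0$, on reading the Tribonacci representation of $n$ (most significant digit first) ends in a state whose output is $b(n)$. -/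

import Mathlib

namespace Tribonacci

/-- The Tribonacci numbers `0, 1, 1, 2, 4, 7, 13, …`. -/
def trib : ℕ → ℕ
  | 0 => 0
  | 1 => 1
  | 2 => 1
  | n + 3 => trib (n + 2) + trib (n + 1) + trib n

theorem existsUnique_root : ∃! x : ℝ, x ^ 3 - x ^ 2 - x - 1 = 0 := by
  have hc : ContinuousOn (fun x : ℝ => x ^ 3 - x ^ 2 - x - 1) (Set.Icc 1 2) := by fun_prop
  have h0 : (0 : ℝ) ∈ Set.Icc ((1 : ℝ) ^ 3 - 1 ^ 2 - 1 - 1) ((2 : ℝ) ^ 3 - 2 ^ 2 - 2 - 1) := by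
    constructor <;> norm_num
  obtain ⟨x, hx, hx0⟩ := intermediate_value_Icc (by norm_num : (1 : ℝ) ≤ 2) hc h0
  refine ⟨x, hx0, fun y hy => ?_⟩
  have hx1 : x ^ 3 - x ^ 2 - x - 1 = 0 := hx0
  have hxl : 1 ≤ x := hx.1
  by_contra hne
  have hfac : (y - x) * (y ^ 2 + x * y + x ^ 2 - y - x - 1) = 0 := by
    linear_combination hy - hx1
  have hq : y ^ 2 + x * y + x ^ 2 - y - x - 1 = 0 :=
    (mul_eq_zero.mp hfac).resolve_left (sub_ne_zero.mpr hne)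
  have hx2 : (9 : ℝ) / 5 < x := by
    by_contra hcon
    push Not at hcon
    nlinarith [mul_nonneg (sub_nonneg.mpr hxl) (sub_nonneg.mpr hcon),
      mul_nonneg (mul_nonneg (sub_nonneg.mpr hxl) (sub_nonneg.mpr hcon)) (by linarith : 0 ≤ x)]
  nlinarith [sq_nonneg (2 * y + x - 1), mul_pos (sub_pos.mpr hx2) (sub_pos.mpr hx2)]

/-- The Tribonacci constant `ψ = 1.839…`: the unique real zero of `X³ - X² - X - 1`. -/
noncomputable def psi : ℝ := existsUnique_root.choose

theorem psi_spec : psi ^ 3 - psi ^ 2 - psi - 1 = 0 := existsUnique_root.choose_spec.1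

/-- The value of a binary word `e_t e_{t-1} ⋯ e_2` (most significant digit first), namely the sum of
`e_i T_i` over `2 ≤ i ≤ t`. -/
def value : List Bool → ℕ
  | [] => 0
  | e :: w => (if e then trib (w.length + 2) else 0) + value w

/-- `w` is the Tribonacci representation of `n`: it has value `n`, it does not use three consecutive
Tribonacci numbers, and it has no leading zero. (The representation of `0` is the empty word.) -/
structure IsRep (n : ℕ) (w : List Bool) : Prop where
  value_eq : value w = n
  no_three_consecutive : ¬ [true, true, true] <:+: w
  no_leading_zero : w.head? ≠ some false

/-- Two words read in parallel: the shorter one is padded on the left with zeros to the length of the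
longer one, and then the two words are zipped to one word over the alphabet of pairs of bits. -/
def parallel (u v : List Bool) : List (Bool × Bool) :=
  (u.leftpad (max u.length v.length) false).zip (v.leftpad (max u.length v.length) false)

/-- A function `f : ℕ → ℕ` is Tribonacci-synchronized if some finite automaton that reads the
Tribonacci representations of `n` and `x` in parallel accepts exactly when `x = f n`. -/
def IsSynchronized (f : ℕ → ℕ) : Prop :=
  ∃ (σ : Type) (_ : Finite σ) (M : DFA (Bool × Bool) σ),
    ∀ (n x : ℕ) (u v : List Bool), IsRep n u → IsRep x v →
      (parallel u v ∈ M.accepts ↔ x = f n)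

/-- A deterministic automaton with output: input alphabet `A`, states `σ`, outputs in `D`. -/
structure DFAO (A σ D : Type*) where
  /-- the transition function -/
  step : σ → A → σ
  /-- the initial state -/
  start : σ
  /-- the output function -/
  out : σ → D

/-- The output associated with the last state reached on input `w`. -/
def DFAO.run {A σ D : Type*} (M : DFAO A σ D) (w : List A) : D :=
  M.out (w.foldl M.step M.start)

/-- A sequence `s` is Tribonacci-automatic if some automaton with output and finitely many states
outputs `s n` on the Tribonacci representation of `n`, for every `n`. -/
def IsAutomatic {D : Type*} (s : ℕ → D) : Prop :=
  ∃ (σ : Type) (_ : Finite σ) (M : DFAO Bool σ D),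
    ∀ (n : ℕ) (w : List Bool), IsRep n w → M.run w = s n

end Tribonacci

namespace Tribonacci

/-! The error `ψ T_k - T_{k+1}` is nonzero for `k ≥ 1` and tends to 0, so for large `k` its sign
decides both whether `T_{k+1} = ⌊ψ T_k⌋` and whether `b(T_k - 1) = 0`. The relevant inputs, `10⋯0`
paired with its successor and `(110)^j`, repeat one block, so a finite automaton answers
periodically from some point on (`not_iterate_iff_err_pos`). But no positive power of `beta` is
real, so along any arithmetic progression the errors obey a recurrence with nonreal roots, and their
sign cannot be constant (`not_const_sign`). -/

/-! ### Bounds and irrationality of `ψ` -/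

theorem psi_gt : (9 : ℝ) / 5 < psi := by
  have h := psi_spec
  by_contra hc
  push Not at hc
  nlinarith [mul_nonneg (sq_nonneg psi) (sub_nonneg.mpr hc), sq_nonneg (psi + 1 / 2),
    sq_nonneg (psi - 9 / 5), sq_nonneg (psi + 1)]

theorem psi_lt : psi < (37 : ℝ) / 20 := by
  have h := psi_spec
  have h1 := psi_gt
  by_contra hc
  push Not at hc
  nlinarith [mul_nonneg (sub_nonneg.mpr hc) (sub_nonneg.mpr hc),
    mul_nonneg (mul_nonneg (sub_nonneg.mpr hc) (sub_nonneg.mpr hc)) (by linarith : 0 ≤ psi)]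

theorem irrational_psi : Irrational psi := by
  rintro ⟨q, hq⟩
  have h := psi_spec
  rw [← hq] at h
  have h' : q ^ 3 - q ^ 2 - q - 1 = 0 := by exact_mod_cast h
  have hd : (q.den : ℚ) ≠ 0 := by exact_mod_cast q.den_ne_zero
  have hz : q.num ^ 3 = q.den * (q.num ^ 2 + q.num * q.den + (q.den : ℤ) ^ 2) := by
    have hqq : q = q.num / q.den := (Rat.num_div_den q).symm
    rw [hqq] at h'
    field_simp at h'
    have : (q.num : ℚ) ^ 3 = q.den * (q.num ^ 2 + q.num * q.den + (q.den : ℚ) ^ 2) := by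
      linear_combination h'
    exact_mod_cast this
  have hcop : IsCoprime (q.den : ℤ) (q.num ^ 3) :=
    (Int.isCoprime_iff_gcd_eq_one.mpr (by
      rw [Int.gcd_comm]; simpa [Int.gcd] using q.reduced)).pow_right
  have hu : IsUnit (q.den : ℤ) := hcop.isUnit_of_dvd' dvd_rfl ⟨_, hz⟩
  have h1 : q.den = 1 := by simpa [Int.isUnit_iff] using hu
  have hqn : (q.num : ℚ) = q := Rat.coe_int_num_of_den_eq_one h1
  have hr : (q.num : ℝ) = psi := by rw [← hq, ← hqn]; simp
  have ha := psi_gt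
  have hb := psi_lt
  rw [← hr] at ha hb
  have h2 : (1 : ℤ) < q.num := by
    have : (1 : ℝ) < q.num := by linarith
    exact_mod_cast this
  have h3 : q.num < 2 := by
    have : (q.num : ℝ) < 2 := by linarith
    exact_mod_cast this
  omega

/-- A real solution of a second order linear recurrence whose characteristic roots are not real
does not stay positive. -/
theorem not_forall_pos_of_recurrence {y : ℕ → ℝ} {t r : ℝ} (h : t ^ 2 < 4 * r)
    (hrec : ∀ j, y (j + 2) = t * y (j + 1) - r * y j) : ¬ ∀ j, 0 < y j := by
  intro hpos
  have hr : 0 < r := by nlinarith [sq_nonneg t]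
  have hs := Real.sq_sqrt hr.le
  have hs0 := Real.sqrt_pos.mpr hr
  have hδ : 0 < 2 * √r - t := by nlinarith
  -- The ratio `x` of successive terms becomes `t - r / x`; since `x + r / x ≥ 2√r`, it drops by at
  -- least `2√r - t > 0` each time and cannot stay positive.
  have hle : ∀ j, y (j + 1) / y j ≤ y 1 / y 0 - j * (2 * √r - t) := by
    intro j
    induction j with
    | zero => simp
    | succ j ih =>
      have h0 := hpos j
      have h1 := hpos (j + 1)
      have hstep : y (j + 2) / y (j + 1) ≤ y (j + 1) / y j - (2 * √r - t) := by
        rw [hrec j, ← sub_nonneg]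
        have : y (j + 1) / y j - (2 * √r - t) - (t * y (j + 1) - r * y j) / y (j + 1)
            = (y (j + 1) - √r * y j) ^ 2 / (y j * y (j + 1)) := by
          field_simp
          linear_combination (-(y j) ^ 2) * hs
        rw [this]
        positivity
      push_cast
      linarith
  obtain ⟨n, hn⟩ := exists_nat_gt (y 1 / y 0 / (2 * √r - t))
  rw [div_lt_iff₀ hδ] at hn
  have := div_pos (hpos (n + 1)) (hpos n)
  linarith [hle n]

/-! ### Errors and powers of `beta` -/

/-- The error of `T_{k+1}` as an approximation of `ψ T_k`. -/
noncomputable def err (k : ℕ) : ℝ := psi * trib k - trib (k + 1)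

/-- A nonreal conjugate of `ψ`. -/
noncomputable def beta : ℂ :=
  ⟨(1 - psi) / 2, √(4 * (psi ^ 2 - psi - 1) - (psi - 1) ^ 2) / 2⟩

theorem beta_im_pos : 0 < beta.im := by
  have h1 := psi_gt
  have h2 := psi_lt
  refine div_pos (Real.sqrt_pos.mpr ?_) two_pos
  nlinarith

theorem normSq_beta : Complex.normSq beta = psi ^ 2 - psi - 1 := by
  have h1 := psi_gt
  have h2 := psi_lt
  have h : 0 ≤ 4 * (psi ^ 2 - psi - 1) - (psi - 1) ^ 2 := by nlinarith
  rw [Complex.normSq_apply]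
  simp only [beta]
  nlinarith [Real.sq_sqrt h]

theorem sq_eq_of_complex (z : ℂ) : z ^ 2 = (2 * z.re : ℝ) * z - (Complex.normSq z : ℝ) := by
  apply Complex.ext <;> simp [pow_two, Complex.normSq_apply] <;> ring

/-- This quadratic is the cofactor of `X - ψ` in `X³ - X² - X - 1`. -/
theorem beta_sq : beta ^ 2 = (1 - psi) * beta - (psi ^ 2 - psi - 1) := by
  have h := sq_eq_of_complex beta
  rw [normSq_beta] at h
  rw [h, show beta.re = (1 - psi) / 2 from rfl]
  push_cast
  ring

theorem beta_cube : beta ^ 3 = beta ^ 2 + beta + 1 := by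
  have h : (psi : ℂ) ^ 3 - psi ^ 2 - psi - 1 = 0 := by exact_mod_cast psi_spec
  linear_combination (beta - psi) * beta_sq + h

theorem exists_beta_pow (n : ℕ) : ∃ A B C : ℕ, 0 < A ∧
    beta ^ (n + 2) = A * beta ^ 2 + B * beta + C := by
  induction n with
  | zero => exact ⟨1, 0, 0, one_pos, by simp⟩
  | succ n ih =>
    obtain ⟨A, B, C, hA, h⟩ := ih
    refine ⟨A + B, A + C, A, by omega, ?_⟩
    rw [show n + 1 + 2 = (n + 2) + 1 by ring, pow_succ, h]
    push_cast
    linear_combination (A : ℂ) * beta_cube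

/-- With `A > 0` from `exists_beta_pow`, a real power would give `A (1 - ψ) + B = 0`, making `ψ`
rational. -/
theorem beta_pow_im_ne_zero {p : ℕ} (hp : 0 < p) : (beta ^ p).im ≠ 0 := by
  obtain rfl | ⟨n, rfl⟩ : p = 1 ∨ ∃ n, p = n + 2 := by
    rcases p with _ | _ | n
    · omega
    · exact Or.inl rfl
    · exact Or.inr ⟨n, rfl⟩
  · simpa using beta_im_pos.ne'
  · obtain ⟨A, B, C, hA, h⟩ := exists_beta_pow n
    rw [h, beta_sq]
    have hA' : (A : ℝ) ≠ 0 := by exact_mod_cast hA.ne'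
    have him : (((A : ℂ) * ((1 - psi) * beta - (psi ^ 2 - psi - 1)) + B * beta + C)).im
        = (A * (1 - psi) + B) * beta.im := by
      have : ((A : ℂ) * ((1 - psi) * beta - (psi ^ 2 - psi - 1)) + B * beta + C)
          = ((A * (1 - psi) + B : ℝ) : ℂ) * beta
            + ((C - A * (psi ^ 2 - psi - 1) : ℝ) : ℂ) := by
        push_cast
        ring
      rw [this, Complex.add_im, Complex.im_ofReal_mul, Complex.ofReal_im, add_zero]
    rw [him]
    refine mul_ne_zero (fun h0 => ?_) beta_im_pos.ne'
    refine irrational_psi ⟨((A + B : ℕ) : ℚ) / A, ?_⟩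
    push_cast
    field_simp
    linarith

theorem err_add_two (k : ℕ) :
    err (k + 2) = (1 - psi) * err (k + 1) - (psi ^ 2 - psi - 1) * err k := by
  have ht : (trib (k + 3) : ℝ) = trib (k + 2) + trib (k + 1) + trib k := by
    exact_mod_cast (show trib (k + 3) = _ from by rw [trib])
  simp only [err]
  rw [ht]
  linear_combination (trib k : ℝ) * psi_spec

/-- The eigenvector component of the errors that belongs to `beta`. -/
theorem err_eigen (k : ℕ) :
    (err (k + 1) : ℂ) - (1 - psi - beta) * err k
      = beta ^ k * (err 1 - (1 - psi - beta) * err 0) := by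
  induction k with
  | zero => simp
  | succ k ih =>
    rw [pow_succ, mul_right_comm, ← ih, err_add_two]
    push_cast
    linear_combination (-(err k : ℂ)) * beta_sq

theorem exists_err_eq : ∃ w : ℂ, ∀ k, err k = (beta ^ k * w).im := by
  have hb := beta_im_pos
  -- Since `1 - ψ - beta` is the conjugate of `beta`, the left side of `err_eigen` has imaginary
  -- part `beta.im * err k`.
  refine ⟨((beta.im)⁻¹ : ℝ) * (err 1 - (1 - psi - beta) * err 0), fun k => ?_⟩
  rw [mul_left_comm, ← err_eigen, Complex.im_ofReal_mul]
  have : ((err (k + 1) : ℂ) - (1 - psi - beta) * err k).im = beta.im * err k := by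
    simp
  rw [this]
  field_simp

theorem err_ne_zero {k : ℕ} (hk : trib k ≠ 0) : err k ≠ 0 := by
  intro h
  refine irrational_psi ⟨(trib (k + 1) : ℚ) / trib k, ?_⟩
  have hk' : (trib k : ℝ) ≠ 0 := by exact_mod_cast hk
  push_cast
  rw [err] at h
  field_simp
  linarith

theorem trib_pos (k : ℕ) : 0 < trib (k + 1) := by
  induction k using Nat.strong_induction_on with
  | _ k ih =>
    match k with
    | 0 => simp [trib]
    | 1 => simp [trib]
    | k + 2 =>
      rw [trib]
      have := ih k (by omega)
      omega

theorem tendsto_err : Filter.Tendsto err Filter.atTop (nhds 0) := by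
  obtain ⟨w, hw⟩ := exists_err_eq
  have hn : ‖beta‖ < 1 := by
    have h1 := psi_gt
    have h2 := psi_lt
    have h3 := normSq_beta
    rw [Complex.normSq_eq_norm_sq] at h3
    nlinarith [norm_nonneg beta]
  have h := ((tendsto_pow_atTop_nhds_zero_of_norm_lt_one hn).mul_const w)
  rw [zero_mul] at h
  have h' := (Complex.continuous_im.tendsto 0).comp h
  rw [Complex.zero_im] at h'
  exact h'.congr fun k => (hw k).symm

theorem err_recurrence_progression {p : ℕ} (hp : 0 < p) (a : ℕ) : ∃ t r : ℝ, t ^ 2 < 4 * r ∧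
    ∀ j, err (a + p * (j + 2)) = t * err (a + p * (j + 1)) - r * err (a + p * j) := by
  obtain ⟨w, hw⟩ := exists_err_eq
  -- Trace and norm of `beta ^ p`; the discriminant is negative because `beta ^ p` is not real.
  refine ⟨2 * (beta ^ p).re, Complex.normSq (beta ^ p), ?_, fun j => ?_⟩
  · rw [Complex.normSq_apply]
    have := pow_pos (abs_pos.mpr (beta_pow_im_ne_zero hp)) 2
    rw [sq_abs] at this
    nlinarith
  · rw [hw, hw, hw, ← Complex.im_ofReal_mul, ← Complex.im_ofReal_mul, ← Complex.sub_im]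
    congr 1
    have h := sq_eq_of_complex (beta ^ p)
    simp only [pow_add, mul_add, pow_mul, mul_one]
    linear_combination beta ^ a * (beta ^ p) ^ j * w * h

/-- The signs of the errors are not constant on any arithmetic progression. -/
theorem not_const_sign {p : ℕ} (hp : 0 < p) (a : ℕ) :
    (¬ ∀ j, 0 < err (a + p * j)) ∧ ¬ ∀ j, err (a + p * j) < 0 := by
  obtain ⟨t, r, htr, hrec⟩ := err_recurrence_progression hp a
  refine ⟨not_forall_pos_of_recurrence htr hrec, fun h => ?_⟩
  refine not_forall_pos_of_recurrence (y := fun j => -err (a + p * j)) htr (fun j => ?_)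
    fun j => neg_pos.mpr (h j)
  simp only [hrec j]
  ring

/-! ### Finite automata on repeated blocks -/

theorem exists_iterate_periodic {σ : Type*} [Finite σ] (f : σ → σ) (q : σ) (N : ℕ) :
    ∃ a p, N ≤ a ∧ 0 < p ∧ ∀ j, f^[a + p * j] q = f^[a] q := by
  obtain ⟨i, j, hij, h⟩ := Finite.exists_ne_map_eq_of_infinite (fun i : ℕ => f^[N + i] q)
  wlog hlt : i < j generalizing i j
  · exact this j i hij.symm h.symm (by omega)
  refine ⟨N + i, j - i, by omega, by omega, fun m => ?_⟩
  have hp : f^[j - i] (f^[N + i] q) = f^[N + i] q := by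
    rw [← Function.iterate_add_apply, show j - i + (N + i) = N + j by omega]
    exact h.symm
  rw [add_comm, Function.iterate_add_apply, Function.iterate_mul]
  exact Function.iterate_fixed hp m

/-- No finite automaton determines the signs of the errors along an arithmetic progression of
indices by iterating one transition. -/
theorem not_iterate_iff_err_pos {σ : Type*} [Finite σ] (f : σ → σ) (q : σ) (P : σ → Prop)
    {m : ℕ} (hm : 0 < m) (c N : ℕ) :
    ¬ ∀ k, N ≤ k → (P (f^[k] q) ↔ 0 < err (m * k + (c + 1))) := by
  intro h
  obtain ⟨a, p, ha, hp, hper⟩ := exists_iterate_periodic f q N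
  have hall : ∀ j, (P (f^[a] q) ↔ 0 < err (m * a + (c + 1) + m * p * j)) := fun j => by
    rw [← hper j, h _ (ha.trans (Nat.le_add_right _ _))]
    ring_nf
  obtain ⟨h1, h2⟩ := not_const_sign (Nat.mul_pos hm hp) (m * a + (c + 1))
  by_cases hP : P (f^[a] q)
  · exact h1 fun j => (hall j).mp hP
  · refine h2 fun j => lt_of_le_of_ne (not_lt.mp fun h0 => hP ((hall j).mpr h0)) ?_
    refine err_ne_zero ?_
    rw [show m * a + (c + 1) + m * p * j = (m * a + c + m * p * j) + 1 by ring]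
    exact (trib_pos _).ne'

/-! ### Synchronization -/

theorem value_replicate_false (k : ℕ) : value (List.replicate k false) = 0 := by
  induction k with
  | zero => rfl
  | succ k ih => simpa [List.replicate_succ, value] using ih

theorem isRep_trib (k : ℕ) : IsRep (trib (k + 2)) (true :: List.replicate k false) := by
  refine ⟨by simp [value, value_replicate_false], fun h => ?_, by simp⟩
  have := h.sublist.count_le true
  simp [List.count_replicate] at this

theorem parallel_trib (k : ℕ) :
    parallel (true :: List.replicate k false) (true :: List.replicate (k + 1) false)
      = (false, true) :: (true, false) :: List.replicate k (false, false) := by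
  simp [parallel, List.leftpad, List.replicate_succ, List.zip_replicate']

theorem foldl_replicate {α σ : Type*} (f : σ → α → σ) (q : σ) (a : α) (k : ℕ) :
    (List.replicate k a).foldl f q = (fun s => f s a)^[k] q := by
  induction k generalizing q with
  | zero => rfl
  | succ k ih => simp [List.replicate_succ, ih]

theorem eventually_abs_err_lt : ∃ N, ∀ k, N ≤ k → |err k| < 1 / 10 := by
  obtain ⟨N, hN⟩ := Metric.tendsto_atTop.mp tendsto_err (1 / 10) (by norm_num)
  exact ⟨N, fun k hk => by simpa using hN k hk⟩

theorem trib_eq_floor_iff {k : ℕ} (h : |err (k + 1)| < 1 / 10) :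
    trib (k + 2) = ⌊psi * (trib (k + 1) : ℝ)⌋₊ ↔ 0 < err (k + 1) := by
  have hψ := psi_gt
  have hne := err_ne_zero (trib_pos k).ne'
  have hx : psi * (trib (k + 1) : ℝ) = trib (k + 2) + err (k + 1) := by rw [err]; ring
  rw [eq_comm, Nat.floor_eq_iff (by positivity), hx]
  rw [abs_lt] at h
  constructor
  · rintro ⟨h1, -⟩
    exact lt_of_le_of_ne (by linarith) hne.symm
  · intro h0
    constructor <;> linarith

theorem not_isSynchronized : ¬ IsSynchronized (fun n : ℕ => ⌊psi * (n : ℝ)⌋₊) := by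
  rintro ⟨σ, _, M, hM⟩
  obtain ⟨N, hN⟩ := eventually_abs_err_lt
  refine not_iterate_iff_err_pos (fun s => M.step s (false, false))
    (M.step (M.step M.start (false, true)) (true, false)) (· ∈ M.accept) one_pos 1 N
    fun k hk => ?_
  have h := hM _ _ _ _ (isRep_trib k) (isRep_trib (k + 1))
  rw [parallel_trib, DFA.mem_accepts, DFA.eval, DFA.evalFrom] at h
  simp only [List.foldl_cons, foldl_replicate] at h
  rw [h, one_mul]
  exact trib_eq_floor_iff (hN _ (by omega))

/-! ### The Sturmian sequence -/

/-- The word `(110)^j`, the representation of `T_{3j+2} - 1`. -/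
def predWord : ℕ → List Bool
  | 0 => []
  | j + 1 => true :: true :: false :: predWord j

theorem length_predWord (j : ℕ) : (predWord j).length = 3 * j := by
  induction j with
  | zero => rfl
  | succ j ih => simp [predWord, ih]; ring

theorem value_predWord (j : ℕ) : value (predWord j) + 1 = trib (3 * j + 2) := by
  induction j with
  | zero => rfl
  | succ j ih =>
    rw [show 3 * (j + 1) + 2 = (3 * j + 2) + 3 by ring, trib, ← ih]
    simp [predWord, value, length_predWord]
    ring

theorem isRep_predWord (j : ℕ) : IsRep (trib (3 * j + 2) - 1) (predWord j) := by
  refine ⟨by have := value_predWord j; omega, ?_, by cases j <;> simp [predWord]⟩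
  induction j with
  | zero => simp [predWord]
  | succ j ih => simpa [predWord, List.infix_cons_iff, List.cons_prefix_cons] using ih

theorem foldl_predWord {σ : Type*} (f : σ → Bool → σ) (q : σ) (j : ℕ) :
    (predWord j).foldl f q = (fun s => f (f (f s true) true) false)^[j] q := by
  induction j generalizing q with
  | zero => rfl
  | succ j ih => simp [predWord, ih]

/-- At `n = T_{k+1} - 1` the two floor arguments are an integer plus `err (k + 1)` and plus `err (k
+ 1) + ψ - 1`. As `9/5 < ψ < 37/20`, the bound `1/10` keeps the latter in `(0, 1)`, so only the sign
of the error matters. -/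
theorem sturmian_eq_zero_iff {k : ℕ} (h : |err (k + 1)| < 1 / 10) :
    ⌊(psi - 1) * (((trib (k + 1) - 1 : ℕ) : ℝ) + 2)⌋
      - ⌊(psi - 1) * (((trib (k + 1) - 1 : ℕ) : ℝ) + 1)⌋ = 0 ↔ 0 < err (k + 1) := by
  have h1 := psi_gt
  have h2 := psi_lt
  have hne := err_ne_zero (trib_pos k).ne'
  rw [Nat.cast_sub (trib_pos k)]
  set z : ℤ := (trib (k + 2) : ℤ) - trib (k + 1) with hz
  have hzr : (z : ℝ) = trib (k + 2) - trib (k + 1) := by rw [hz]; push_cast; rfl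
  have e1 : (psi - 1) * ((trib (k + 1) : ℝ) - (1 : ℕ) + 2) = z + (err (k + 1) + (psi - 1)) := by
    rw [hzr, err]; push_cast; ring
  have e2 : (psi - 1) * ((trib (k + 1) : ℝ) - (1 : ℕ) + 1) = z + err (k + 1) := by
    rw [hzr, err]; push_cast; ring
  rw [abs_lt] at h
  have hf : ⌊err (k + 1) + (psi - 1)⌋ = 0 :=
    Int.floor_eq_zero_iff.mpr ⟨by linarith, by linarith⟩
  rw [e1, e2, Int.floor_intCast_add, Int.floor_intCast_add, hf, add_zero,
    sub_add_cancel_left, neg_eq_zero, Int.floor_eq_zero_iff]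
  exact ⟨fun h0 => lt_of_le_of_ne h0.1 hne.symm, fun h0 => ⟨h0.le, by linarith⟩⟩

theorem not_isAutomatic : ¬ IsAutomatic (fun n : ℕ =>
    ⌊(psi - 1) * ((n : ℝ) + 2)⌋ - ⌊(psi - 1) * ((n : ℝ) + 1)⌋) := by
  rintro ⟨σ, _, M, hM⟩
  obtain ⟨N, hN⟩ := eventually_abs_err_lt
  refine not_iterate_iff_err_pos (fun s => M.step (M.step (M.step s true) true) false) M.start
    (fun s => M.out s = 0) (m := 3) (by norm_num) 1 N fun j hj => ?_
  have h := hM _ _ (isRep_predWord j)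
  rw [DFAO.run, foldl_predWord] at h
  rw [h]
  exact sturmian_eq_zero_iff (hN _ (by omega))

end Tribonacci

theorem theorem1 :
    ¬ Tribonacci.IsSynchronized (fun n : ℕ => ⌊Tribonacci.psi * (n : ℝ)⌋₊) ∧
    ¬ Tribonacci.IsAutomatic (fun n : ℕ =>
        ⌊(Tribonacci.psi - 1) * ((n : ℝ) + 2)⌋ - ⌊(Tribonacci.psi - 1) * ((n : ℝ) + 1)⌋) :=
  ⟨Tribonacci.not_isSynchronized, Tribonacci.not_isAutomatic⟩
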